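/- For $x\in\mathbb{R}$ let $\|x\|$ denote the distance from $x$ to the nearest integer. An irrational number $\alpha$ is called badly approximable if $\inf_{n\ge 1} n\|n\alpha\|>0$, the infimum being over all positive integers $n$. Let $\alpha$ be a badly approximable irrational. Then for every integer $N\ge 1$, \[ \sum_{n=1}^N \frac{1}{\|n\alpha\|} = 2N\log N+O(N) \qquad\text{and}\qquad \sum_{n=1}^N \frac{1}{n\|n\alpha\|} = (\log N)^2+O\bigl(\log\max\{e,N\}\bigr), \] with implied constants depending only on $\alpha$. -/

import Mathlib

/-- The distance from a real number to the nearest integer, usually written `‖x‖`. -/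
noncomputable def distNearestInt (x : ℝ) : ℝ := |x - (round x : ℝ)|

/-- An irrational number `α` is badly approximable if the infimum of `n * ‖n α‖` over all
positive integers `n` is positive. The family is nonnegative, so the real infimum is genuine. -/
def IsBadlyApproximable (α : ℝ) : Prop :=
  Irrational α ∧ 0 < ⨅ n : ℕ+, ((n : ℕ) : ℝ) * distNearestInt (((n : ℕ) : ℝ) * α)

open Finset

/-! If `p / q` is a Dirichlet approximation with `|α - p / q| ≤ 1 / q ^ 2`, then `q` consecutive
multiples of `α` are, mod 1, the points `r / q` moved by at most `2 / q`. Away from 0 this barely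
changes the reciprocals, and near 0 bad approximability bounds them, so the block sums to `2 q log q
+ O(q)` (`abs_sum_one_div_distNearestInt_block_le`). Dirichlet at level `N` gives `q ≤ N`, and bad
approximability forces `q ≥ c N`. Strong induction removes the last `q` terms; the defect of `x log
x` from additivity is `O(N) = O(q)`, so the errors add up to `O(N)`. The second estimate follows by
partial summation. -/

lemma distNearestInt_nonneg (x : ℝ) : 0 ≤ distNearestInt x := abs_nonneg _

lemma distNearestInt_le (x : ℝ) (z : ℤ) : distNearestInt x ≤ |x - z| := round_le x z

lemma IsBadlyApproximable.exists_le {α : ℝ} (hα : IsBadlyApproximable α) :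
    ∃ c : ℝ, 0 < c ∧ c ≤ 1 ∧ ∀ n : ℕ, 1 ≤ n → c ≤ n * distNearestInt (n * α) := by
  refine ⟨min 1 (⨅ n : ℕ+, ((n : ℕ) : ℝ) * distNearestInt (((n : ℕ) : ℝ) * α)),
    lt_min one_pos hα.2, min_le_left _ _, fun n hn => (min_le_right _ _).trans ?_⟩
  refine ciInf_le (f := fun n : ℕ+ => ((n : ℕ) : ℝ) * distNearestInt (((n : ℕ) : ℝ) * α))
    ⟨0, ?_⟩ (⟨n, hn⟩ : ℕ+)
  rintro _ ⟨m, rfl⟩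
  exact mul_nonneg (Nat.cast_nonneg _) (distNearestInt_nonneg _)

/-! ### Comparison of a single reciprocal with its lattice model -/

/-- A point within `e` of `z + t`, with `z` an integer and `t ∈ [0, 1]`, has distance to the
nearest integer within `e` of `min t (1 - t)`. -/
lemma abs_distNearestInt_sub_min_le {x t e : ℝ} {z : ℤ} (ht0 : 0 ≤ t) (ht1 : t ≤ 1)
    (h : |x - z - t| ≤ e) : |distNearestInt x - min t (1 - t)| ≤ e := by
  rw [abs_le] at h
  have h0 := distNearestInt_le x z
  have h1 := distNearestInt_le x (z + 1)
  push_cast at h1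
  rw [abs_le]
  constructor
  · have key : min t (1 - t) ≤ |x - round x| + e := by
      rcases le_or_gt (round x) z with hz | hz
      · have : (round x : ℝ) ≤ z := by exact_mod_cast hz
        exact (min_le_left _ _).trans (by linarith [le_abs_self (x - round x)])
      · have : (z : ℝ) + 1 ≤ round x := by exact_mod_cast hz
        exact (min_le_right _ _).trans (by linarith [neg_abs_le (x - round x)])
    unfold distNearestInt
    linarith
  · rw [sub_le_iff_le_add, ← min_add_add_left]
    refine le_min (h0.trans ?_) (h1.trans ?_) <;> rw [abs_le] <;> constructor <;> linarith

/-- If `X` is within `3` of `min a b` and bounded below by `κ`, then `1 / X` is close to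
`1 / a + 1 / b`. -/
lemma abs_one_div_sub_le {κ X a b : ℝ} (hκ : 0 < κ) (hX : κ ≤ X) (ha : 1 ≤ a) (hb : 1 ≤ b)
    (h : |X - min a b| ≤ 3) :
    |1 / X - (1 / a + 1 / b)| ≤
      3 * (1 + 3 / κ) * (1 / a ^ 2 + 1 / b ^ 2) + 2 / (a + b) := by
  wlog hab : a ≤ b generalizing a b
  · have := this hb ha (by rwa [min_comm]) (le_of_not_ge hab)
    rwa [add_comm (1 / b), add_comm (1 / b ^ 2), add_comm b] at this
  rw [min_eq_left hab] at h
  have hX0 : 0 < X := hκ.trans_le hX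
  have ha0 : 0 < a := by linarith
  have hb0 : 0 < b := by linarith
  have haX : a ≤ (1 + 3 / κ) * X := by
    have h3 : 3 ≤ 3 / κ * X := by
      rw [div_mul_eq_mul_div, le_div_iff₀ hκ]; linarith
    linarith [(abs_le.1 h).1]
  have hinv : 1 / X ≤ (1 + 3 / κ) / a := by
    rw [div_le_div_iff₀ hX0 ha0]; linarith
  have h1 : |1 / X - 1 / a| ≤ 3 * (1 + 3 / κ) * (1 / a ^ 2) := by
    have e : 1 / X - 1 / a = (a - X) * (1 / X) * (1 / a) := by field_simp
    rw [e, abs_mul, abs_mul, abs_sub_comm, abs_of_pos (one_div_pos.2 hX0),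
      abs_of_pos (one_div_pos.2 ha0)]
    calc |X - a| * (1 / X) * (1 / a) ≤ 3 * ((1 + 3 / κ) / a) * (1 / a) := by gcongr
      _ = _ := by field_simp
  -- The term of the farther endpoint is itself within the error.
  have h2 : 1 / b ≤ 2 / (a + b) := by
    rw [div_le_div_iff₀ hb0 (by linarith)]; linarith
  have h3 : 0 ≤ 3 * (1 + 3 / κ) * (1 / b ^ 2) := by positivity
  have h4 : |1 / b| = 1 / b := abs_of_pos (one_div_pos.2 hb0)
  calc |1 / X - (1 / a + 1 / b)| = |(1 / X - 1 / a) - 1 / b| := by ring_nf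
    _ ≤ |1 / X - 1 / a| + |1 / b| := abs_sub _ _
    _ ≤ _ := by rw [h4, mul_add]; linarith

/-! ### Sum over one block of length `q` -/

/-- An affine map with multiplier coprime to `q` permutes the residues modulo `q`. -/
lemma sum_range_affine_emod {q : ℕ} (hq : 0 < q) (b : ℤ) {p : ℤ} (hpq : IsCoprime p (q : ℤ))
    (G : ℕ → ℝ) :
    ∑ i ∈ range q, G ((b + i * p) % q).toNat = ∑ r ∈ range q, G r := by
  have hq' : (0 : ℤ) < q := by exact_mod_cast hq
  have hinj : Set.InjOn (fun i : ℕ => ((b + i * p) % q).toNat) (range q : Finset ℕ) := by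
    intro i hi j hj hij
    simp only [coe_range, Set.mem_Iio] at hi hj
    have hi0 := Int.emod_nonneg (b + i * p) hq'.ne'
    have hj0 := Int.emod_nonneg (b + j * p) hq'.ne'
    have h : (b + i * p) % q = (b + j * p) % q := by
      simp only at hij; omega
    have h' : (q : ℤ) ∣ ((j : ℤ) - i) * p := by
      have := Int.ModEq.dvd h
      rwa [show b + (j : ℤ) * p - (b + i * p) = ((j : ℤ) - i) * p by ring] at this
    have hd : (q : ℤ) ∣ (j : ℤ) - i := hpq.symm.dvd_of_dvd_mul_right h'
    have := Int.eq_zero_of_abs_lt_dvd hd (by rw [abs_lt]; omega)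
    omega
  have himg : (range q).image (fun i : ℕ => ((b + i * p) % q).toNat) = range q := by
    refine eq_of_subset_of_card_le ?_ ?_
    · intro r hr
      obtain ⟨i, -, rfl⟩ := mem_image.1 hr
      have := Int.emod_nonneg (b + i * p) hq'.ne'
      have := Int.emod_lt_of_pos (b + i * p) hq'
      simp only [mem_range]
      omega
    · rw [card_image_of_injOn hinj]
  conv_rhs => rw [← himg, sum_image hinj]

lemma sum_range_one_div_sq_le (q : ℕ) :
    ∑ r ∈ range q, 1 / ((r : ℝ) + 1) ^ 2 ≤ 2 := by
  suffices h : ∀ q : ℕ, 1 ≤ q →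
      ∑ r ∈ range q, 1 / ((r : ℝ) + 1) ^ 2 ≤ 2 - 1 / (q : ℝ) by
    rcases Nat.eq_zero_or_pos q with rfl | hq
    · simp
    · exact (h q hq).trans (by linarith [show (0 : ℝ) ≤ 1 / (q : ℝ) by positivity])
  intro q hq
  induction q, hq using Nat.le_induction with
  | base => norm_num
  | succ n hn ih =>
    have hn0 : (0 : ℝ) < n := by exact_mod_cast hn
    rw [sum_range_succ]
    have : 1 / ((n : ℝ) + 1) ^ 2 ≤ 1 / (n : ℝ) - 1 / ((n : ℝ) + 1) := by
      rw [div_sub_div _ _ hn0.ne' (by positivity), div_le_div_iff₀ (by positivity) (by positivity)]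
      nlinarith
    push_cast
    linarith

lemma log_succ_sub_log_bounds {n : ℝ} (hn : 0 < n) :
    1 / (n + 1) ≤ Real.log (n + 1) - Real.log n ∧ Real.log (n + 1) - Real.log n ≤ 1 / n := by
  have h1 : 0 < n + 1 := by linarith
  constructor
  · have := Real.log_le_sub_one_of_pos (div_pos hn h1)
    rw [Real.log_div hn.ne' h1.ne'] at this
    have e : n / (n + 1) - 1 = -(1 / (n + 1)) := by field_simp; ring
    linarith
  · have := Real.log_le_sub_one_of_pos (div_pos h1 hn)
    rw [Real.log_div h1.ne' hn.ne'] at this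
    have e : (n + 1) / n - 1 = 1 / n := by field_simp; ring
    linarith

lemma abs_sum_range_one_div_sub_log_le {q : ℕ} (hq : 1 ≤ q) :
    |∑ r ∈ range q, 1 / ((r : ℝ) + 1) - Real.log q| ≤ 1 := by
  suffices h : Real.log q + 1 / q ≤ ∑ r ∈ range q, 1 / ((r : ℝ) + 1) ∧
      ∑ r ∈ range q, 1 / ((r : ℝ) + 1) ≤ 1 + Real.log q by
    rw [abs_le]
    have : (0 : ℝ) ≤ 1 / q := by positivity
    constructor <;> linarith [h.1, h.2]
  induction q, hq using Nat.le_induction with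
  | base => norm_num
  | succ n hn ih =>
    have hb := log_succ_sub_log_bounds (n := n) (by exact_mod_cast hn)
    rw [sum_range_succ]
    push_cast
    constructor <;> linarith [ih.1, ih.2, hb.1, hb.2]

/-- The sum of the reciprocals of a perturbed `q`-point lattice on the circle. -/
lemma abs_sum_one_div_distNearestInt_block_le {α κ : ℝ} (hκ : 0 < κ) {q M : ℕ} (hq : 1 ≤ q)
    {p : ℤ} (hpq : IsCoprime p (q : ℤ)) (happ : |α - p / q| ≤ 1 / (q : ℝ) ^ 2)
    (hlow : ∀ i < q, κ ≤ q * distNearestInt (((M + i : ℕ) : ℝ) * α)) :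
    |∑ i ∈ range q, 1 / distNearestInt (((M + i : ℕ) : ℝ) * α) - 2 * q * Real.log q| ≤
      (12 * (1 + 3 / κ) + 4) * q := by
  have hq0 : (0 : ℝ) < q := by exact_mod_cast hq
  set K : ℝ := 3 * (1 + 3 / κ) with hK
  have hK0 : 0 ≤ K := by positivity
  -- `q (M + i) α` is within 2 of `b + i p`: at most 1 from the floor, at most 1 from `q i (α - p /
  -- q)`.
  set b : ℤ := ⌊(q : ℝ) * (M * α)⌋ with hb
  set ref : ℕ → ℝ := fun r => q * (1 / ((r : ℝ) + 1) + 1 / ((q : ℝ) - r)) with href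
  set err : ℕ → ℝ := fun r =>
    q * (K * (1 / ((r : ℝ) + 1) ^ 2 + 1 / ((q : ℝ) - r) ^ 2) + 2 / (q + 1)) with herr
  have hpt : ∀ i ∈ range q, |1 / distNearestInt (((M + i : ℕ) : ℝ) * α)
      - ref ((b + i * p) % q).toNat| ≤ err ((b + i * p) % q).toNat := by
    intro i hi
    have hi' : i < q := mem_range.1 hi
    have hiq : (i : ℝ) ≤ q := by exact_mod_cast hi'.le
    have hq' : (0 : ℤ) < q := by exact_mod_cast hq
    have hr0 := Int.emod_nonneg (b + i * p) hq'.ne'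
    have hr1 := Int.emod_lt_of_pos (b + i * p) hq'
    set z : ℤ := (b + i * p) / q with hz
    obtain ⟨r, hr⟩ := Int.eq_ofNat_of_zero_le hr0
    have hdiv : (r : ℤ) + q * z = b + i * p := by rw [← hr]; exact Int.emod_add_mul_ediv _ _
    rw [hr] at hr1 ⊢
    rw [Int.toNat_natCast]
    have hrq : (r : ℝ) + 1 ≤ q := by exact_mod_cast hr1
    have hdivR : (r : ℝ) + q * z = b + i * p := by exact_mod_cast hdiv
    set x : ℝ := ((M + i : ℕ) : ℝ) * α with hx
    have hfl := Int.floor_le ((q : ℝ) * (M * α))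
    have hfl' := Int.lt_floor_add_one ((q : ℝ) * (M * α))
    rw [← hb] at hfl hfl'
    have hθ : |(q : ℝ) * (i * (α - p / q))| ≤ 1 := by
      rw [abs_mul, abs_mul, abs_of_pos hq0, abs_of_nonneg (Nat.cast_nonneg i)]
      calc (q : ℝ) * (i * |α - p / q|) ≤ q * (q * (1 / (q : ℝ) ^ 2)) := by gcongr
        _ = 1 := by field_simp
    have hqx : (q : ℝ) * (x - z - r / q) = (q * (M * α) - b) + q * (i * (α - p / q)) := by
      have e1 : (q : ℝ) * (x - z - r / q) = q * x - (r + q * z) := by field_simp; ring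
      rw [e1, hdivR, hx]; push_cast; field_simp; ring
    have hclose : |x - z - r / q| ≤ 2 / q := by
      rw [le_div_iff₀ hq0, ← abs_of_pos hq0, ← abs_mul, mul_comm, abs_of_pos hq0, hqx, abs_le]
      rw [abs_le] at hθ
      constructor <;> linarith [hθ.1, hθ.2]
    have hd := abs_distNearestInt_sub_min_le (t := (r : ℝ) / q) (by positivity)
      (by rw [div_le_one hq0]; linarith) hclose
    set X : ℝ := q * distNearestInt x with hX
    have hmin : (q : ℝ) * min ((r : ℝ) / q) (1 - r / q) = min (r : ℝ) (q - r) := by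
      rw [mul_min_of_nonneg _ _ hq0.le]
      congr 1 <;> field_simp
    have hX2 : |X - min (r : ℝ) (q - r)| ≤ 2 := by
      rw [← hmin, hX, ← mul_sub, abs_mul, abs_of_pos hq0, mul_comm]
      rwa [le_div_iff₀ hq0] at hd
    -- Replacing `r` by `r + 1` costs 1 and avoids a zero denominator at `r = 0`.
    have hX3 : |X - min ((r : ℝ) + 1) (q - r)| ≤ 3 := by
      rw [abs_le] at hX2 ⊢
      rcases min_cases (r : ℝ) (q - r) with h | h <;>
        rcases min_cases ((r : ℝ) + 1) (q - r) with h' | h' <;>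
        constructor <;> linarith [hX2.1, hX2.2, h.1, h.2, h'.1, h'.2]
    have hXκ : κ ≤ X := hlow i hi'
    have hX0 : 0 < X := hκ.trans_le hXκ
    have hdx : 1 / distNearestInt x = q * (1 / X) := by
      rw [hX]
      have : distNearestInt x ≠ 0 := by
        rintro h0; rw [hX, h0, mul_zero] at hX0; exact lt_irrefl _ hX0
      field_simp
    have := abs_one_div_sub_le hκ hXκ (a := (r : ℝ) + 1) (b := (q : ℝ) - r)
      (by linarith [show (0 : ℝ) ≤ r from Nat.cast_nonneg r]) (by linarith) hX3
    rw [show (r : ℝ) + 1 + (q - r) = q + 1 by ring] at this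
    simp only [href, herr]
    rw [hdx, ← mul_sub, abs_mul, abs_of_pos hq0]
    gcongr
  have hreflect : ∀ g : ℝ → ℝ, ∑ r ∈ range q, g ((q : ℝ) - r) = ∑ r ∈ range q, g ((r : ℝ) + 1) := by
    intro g
    rw [← sum_range_reflect]
    refine sum_congr rfl fun r hr => ?_
    have hr' := mem_range.1 hr
    congr 1
    rw [Nat.sub_sub, Nat.cast_sub (by omega)]
    push_cast
    ring
  have hrefsum : ∑ r ∈ range q, ref r = 2 * q * ∑ r ∈ range q, 1 / ((r : ℝ) + 1) := by
    simp only [href]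
    rw [← mul_sum, sum_add_distrib, hreflect (fun y => 1 / y)]
    ring
  have herrsum : ∑ r ∈ range q, err r ≤ (12 * (1 + 3 / κ) + 2) * q := by
    simp only [herr]
    rw [← mul_sum, sum_add_distrib, ← mul_sum, sum_add_distrib, hreflect (fun y => 1 / y ^ 2),
      sum_const, card_range, nsmul_eq_mul, mul_comm (q : ℝ) (_ + _)]
    have h1 := mul_le_mul_of_nonneg_left (sum_range_one_div_sq_le q) hK0
    have h2 : (q : ℝ) * (2 / (q + 1)) ≤ 2 := by
      rw [mul_div_assoc', div_le_iff₀ (by positivity)]; linarith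
    refine mul_le_mul_of_nonneg_right ?_ hq0.le
    linarith
  have hmain : |∑ i ∈ range q, 1 / distNearestInt (((M + i : ℕ) : ℝ) * α)
      - ∑ r ∈ range q, ref r| ≤ ∑ r ∈ range q, err r := by
    rw [← sum_range_affine_emod hq b hpq ref, ← sum_range_affine_emod hq b hpq err,
      ← sum_sub_distrib]
    exact (abs_sum_le_sum_abs _ _).trans (sum_le_sum hpt)
  have hlog := abs_sum_range_one_div_sub_log_le hq
  have hlog' : |2 * q * (∑ r ∈ range q, 1 / ((r : ℝ) + 1)) - 2 * q * Real.log q| ≤ 2 * q := by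
    rw [← mul_sub, abs_mul, abs_of_pos (by positivity : (0 : ℝ) < 2 * q)]
    exact mul_le_of_le_one_right (by positivity) hlog
  rw [hrefsum] at hmain
  have := abs_sub_le (∑ i ∈ range q, 1 / distNearestInt (((M + i : ℕ) : ℝ) * α))
    (2 * q * ∑ r ∈ range q, 1 / ((r : ℝ) + 1)) (2 * q * Real.log q)
  linarith

/-! ### Assembling blocks by induction on `N` -/

/-- The function `x ↦ x log x` is additive up to `O(x + y)`. -/
lemma abs_mul_log_add_sub_le {x y : ℝ} (hx : 0 < x) (hy : 0 ≤ y) :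
    |x * Real.log x + y * Real.log y - (x + y) * Real.log (x + y)| ≤ 2 * (x + y) := by
  have key : ∀ u : ℝ, 0 ≤ u → u ≤ x + y →
      u * Real.log u ≤ u * Real.log (x + y) ∧
      u * Real.log (x + y) ≤ u * Real.log u + (x + y) := by
    intro u hu hux
    rcases hu.eq_or_lt with rfl | hu
    · simp; linarith
    have h1 := Real.log_le_log hu hux
    have h2 := Real.log_le_sub_one_of_pos (div_pos (hu.trans_le hux) hu)
    rw [Real.log_div (by linarith) hu.ne'] at h2
    refine ⟨by gcongr, ?_⟩
    have h3 := mul_le_mul_of_nonneg_left h2 hu.le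
    have e : u * ((x + y) / u - 1) = x + y - u := by field_simp
    linarith
  have h1 := key x hx.le (by linarith)
  have h2 := key y hy (by linarith)
  rw [abs_le]
  constructor <;> linarith [h1.1, h1.2, h2.1, h2.2]

lemma IsBadlyApproximable.exists_abs_sum_one_div_sub_le {α : ℝ} (hα : IsBadlyApproximable α) :
    ∃ C : ℝ, 0 ≤ C ∧ ∀ N : ℕ,
      |∑ n ∈ Icc 1 N, 1 / distNearestInt ((n : ℝ) * α) - 2 * (N : ℝ) * Real.log (N : ℝ)|
        ≤ C * (N : ℝ) := by
  obtain ⟨c, hc0, hc1, hc⟩ := hα.exists_le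
  -- For `n ≤ N`, `q ‖nα‖ ≥ (c N) (c / n) ≥ c ^ 2`.
  set κ : ℝ := c ^ 2 with hκ
  have hκ0 : 0 < κ := by positivity
  set B : ℝ := 12 * (1 + 3 / κ) + 4 with hB
  -- `B` pays for the block; `4 / c` pays for twice the defect `2 N` of `x log x`, as `N ≤ q / c`.
  refine ⟨B + 4 / c, by positivity, fun N => ?_⟩
  induction N using Nat.strong_induction_on with
  | _ N ih =>
  rcases Nat.eq_zero_or_pos N with rfl | hN
  · simp
  obtain ⟨s, hs, hsN⟩ := Real.exists_rat_abs_sub_le_and_den_le α hN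
  set q : ℕ := s.den with hqdef
  have hq : 1 ≤ q := s.den_pos
  have hq0 : (0 : ℝ) < q := by exact_mod_cast hq
  have hN0 : (0 : ℝ) < N := by exact_mod_cast hN
  have hqN : (q : ℝ) ≤ N := by exact_mod_cast hsN
  have hsq : (s : ℝ) = (s.num : ℝ) / q := by exact_mod_cast (Rat.num_div_den s).symm
  rw [hsq] at hs
  have hcN : c * N ≤ q := by
    have h1 := distNearestInt_le (q * α) s.num
    have e : (q : ℝ) * α - s.num = q * (α - s.num / q) := by field_simp
    rw [e, abs_mul, abs_of_pos hq0] at h1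
    have h2 : (q : ℝ) * |α - s.num / q| ≤ 1 / (N + 1) := by
      calc (q : ℝ) * |α - s.num / q| ≤ q * (1 / ((N + 1) * q)) := by gcongr
        _ = _ := by field_simp
    have h3 := (hc q hq).trans (mul_le_mul_of_nonneg_left (h1.trans h2) hq0.le)
    rw [mul_one_div, le_div_iff₀ (by positivity)] at h3
    linarith
  have happ : |α - s.num / q| ≤ 1 / (q : ℝ) ^ 2 := by
    refine hs.trans ?_
    rw [sq]
    gcongr
    linarith
  have hcop : IsCoprime s.num (q : ℤ) := by
    rw [Int.isCoprime_iff_gcd_eq_one]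
    exact s.reduced
  obtain ⟨L, rfl⟩ := Nat.exists_eq_add_of_le' hsN
  have hlow : ∀ i < q, κ ≤ q * distNearestInt (((L + 1 + i : ℕ) : ℝ) * α) := by
    intro i hi
    have h1 := hc (L + 1 + i) (by omega)
    have h2 : ((L + 1 + i : ℕ) : ℝ) ≤ ((L + q : ℕ) : ℝ) := by exact_mod_cast (by omega)
    have hd := distNearestInt_nonneg (((L + 1 + i : ℕ) : ℝ) * α)
    calc κ = c * c := by rw [hκ, sq]
      _ ≤ c * (((L + q : ℕ) : ℝ) * distNearestInt (((L + 1 + i : ℕ) : ℝ) * α)) := by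
        gcongr
        exact h1.trans (by gcongr)
      _ = (c * ((L + q : ℕ) : ℝ)) * distNearestInt (((L + 1 + i : ℕ) : ℝ) * α) := by ring
      _ ≤ _ := by gcongr
  have hblock := abs_sum_one_div_distNearestInt_block_le hκ0 hq hcop happ hlow
  have hsplit : ∑ n ∈ Icc 1 (L + q), 1 / distNearestInt ((n : ℝ) * α) =
      ∑ n ∈ Icc 1 L, 1 / distNearestInt ((n : ℝ) * α) +
      ∑ i ∈ range q, 1 / distNearestInt (((L + 1 + i : ℕ) : ℝ) * α) := by
    have hI : ∀ m : ℕ, Icc 1 m = Ico 1 (m + 1) := fun m => by ext; simp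
    rw [hI, hI, ← sum_Ico_consecutive _ (show 1 ≤ L + 1 by omega)
      (show L + 1 ≤ L + q + 1 by omega), sum_Ico_eq_sum_range _ (L + 1),
      show L + q + 1 - (L + 1) = q by omega]
  have hL := ih L (by omega)
  have hent := abs_mul_log_add_sub_le hq0 (Nat.cast_nonneg L : (0 : ℝ) ≤ L)
  have hLq : (((L + q : ℕ) : ℝ)) = (q : ℝ) + L := by push_cast; ring
  have hcN' : 4 * ((q : ℝ) + L) ≤ 4 / c * q := by
    rw [hLq] at hcN
    rw [div_mul_eq_mul_div, le_div_iff₀ hc0]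
    linarith
  rw [hsplit, hLq]
  rw [abs_le] at hL hblock hent ⊢
  constructor <;> linarith [hL.1, hL.2, hblock.1, hblock.2, hent.1, hent.2]

/-! ### Partial summation -/

lemma abs_log_sq_succ_sub_le {n : ℝ} (hn : 1 ≤ n) :
    |2 * Real.log n / (n + 1) - (Real.log (n + 1) ^ 2 - Real.log n ^ 2)| ≤ 4 / (n + 1) := by
  have hn0 : 0 < n := by linarith
  obtain ⟨h1, h2⟩ := log_succ_sub_log_bounds hn0
  have hL0 := Real.log_nonneg hn
  have hLn : Real.log n ≤ n := (Real.log_le_sub_one_of_pos hn0).trans (by linarith)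
  set L := Real.log n
  set d := Real.log (n + 1) - L with hd
  have hd0 : 0 ≤ d := le_trans (by positivity) h1
  have e : 2 * L / (n + 1) - (Real.log (n + 1) ^ 2 - L ^ 2) =
      -(d ^ 2 + 2 * L * (d - 1 / (n + 1))) := by
    rw [show Real.log (n + 1) = d + L by rw [hd]; ring]; ring
  have hA : d ^ 2 ≤ 2 / (n + 1) := by
    calc d ^ 2 ≤ (1 / n) ^ 2 := by gcongr
      _ ≤ 2 / (n + 1) := by
        rw [div_pow, div_le_div_iff₀ (by positivity) (by positivity)]; nlinarith
  -- The crude bound `L ≤ n` suffices, since `d - 1 / (n + 1)` is at most `1 / (n (n + 1))`.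
  have hBound : 2 * L * (d - 1 / (n + 1)) ≤ 2 / (n + 1) := by
    calc 2 * L * (d - 1 / (n + 1)) ≤ 2 * n * (1 / n - 1 / (n + 1)) := by
          have : 0 ≤ d - 1 / (n + 1) := by linarith
          gcongr
      _ = 2 / (n + 1) := by field_simp; ring
  have hpos : 0 ≤ 2 * L * (d - 1 / (n + 1)) := mul_nonneg (by linarith) (by linarith)
  rw [e, abs_neg, abs_of_nonneg (by positivity)]
  calc _ ≤ 2 / (n + 1) + 2 / (n + 1) := add_le_add hA hBound
    _ = 4 / (n + 1) := by ring

/-- Partial summation: if `∑ f(n) = 2 N log N + O(N)`, then `∑ f(n) / n = log² N + O(log N)`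
up to the boundary term. -/
lemma abs_sum_div_sub_log_sq_le {f : ℕ → ℝ} {C : ℝ}
    (hf : ∀ N : ℕ, |∑ n ∈ Icc 1 N, f n - 2 * N * Real.log N| ≤ C * N) {N : ℕ} (hN : 1 ≤ N) :
    |∑ n ∈ Icc 1 N, f n / n - (∑ n ∈ Icc 1 N, f n) / N - Real.log N ^ 2| ≤
      (C + 4) * Real.log N := by
  have hC : 0 ≤ C := by simpa using (abs_nonneg _).trans (hf 1)
  induction N, hN using Nat.le_induction with
  | base => simp
  | succ N hN ih =>
    have hN1 : (1 : ℝ) ≤ N := by exact_mod_cast hN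
    have hN0 : (0 : ℝ) < N := by linarith
    rw [sum_Icc_succ_top (by omega), sum_Icc_succ_top (by omega)]
    set S := ∑ n ∈ Icc 1 N, f n with hS
    set T := ∑ n ∈ Icc 1 N, f n / n
    have h1 := (log_succ_sub_log_bounds hN0).1
    have h2 := abs_log_sq_succ_sub_le hN1
    have h3 : |S / (N * (N + 1)) - 2 * Real.log N / (N + 1)| ≤ C / (N + 1) := by
      have e : S / (N * (N + 1)) - 2 * Real.log N / (N + 1)
          = (S - 2 * N * Real.log N) / (N * (N + 1)) := by field_simp
      rw [e, abs_div, abs_of_pos (by positivity : (0 : ℝ) < N * (N + 1)),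
        div_le_div_iff₀ (by positivity) (by positivity)]
      calc _ ≤ C * N * ((N : ℝ) + 1) := by gcongr; exact hf N
        _ = _ := by ring
    -- Bounding the step error by an increment of `log` makes the total telescope.
    have h4 : C / ((N : ℝ) + 1) + 4 / (N + 1)
        ≤ (C + 4) * (Real.log (N + 1) - Real.log N) := by
      calc C / ((N : ℝ) + 1) + 4 / (N + 1) = (C + 4) * (1 / (N + 1)) := by ring
        _ ≤ _ := by gcongr
    have e : T + f (N + 1) / ((N + 1 : ℕ) : ℝ) - (S + f (N + 1)) / ((N + 1 : ℕ) : ℝ)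
        = T - S / N + S / (N * (N + 1)) := by
      push_cast; field_simp; ring
    rw [e]
    push_cast
    rw [abs_le] at ih h2 h3 ⊢
    constructor <;> linarith [ih.1, ih.2, h2.1, h2.2, h3.1, h3.2]

theorem theorem1 (α : ℝ) (hα : IsBadlyApproximable α) :
    (∃ C : ℝ, ∀ N : ℕ, 1 ≤ N →
      |∑ n ∈ Finset.Icc 1 N, 1 / distNearestInt ((n : ℝ) * α) - 2 * (N : ℝ) * Real.log (N : ℝ)|
        ≤ C * (N : ℝ)) ∧
    (∃ C : ℝ, ∀ N : ℕ, 1 ≤ N →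
      |∑ n ∈ Finset.Icc 1 N, 1 / ((n : ℝ) * distNearestInt ((n : ℝ) * α))
          - (Real.log (N : ℝ)) ^ 2|
        ≤ C * Real.log (max (Real.exp 1) (N : ℝ))) := by
  obtain ⟨C, hC0, hC⟩ := hα.exists_abs_sum_one_div_sub_le
  -- `C + 4` comes from partial summation, `C + 2` from the boundary term `S / N = 2 log N + O(1)`.
  refine ⟨⟨C, fun N _ => hC N⟩, 2 * C + 6, fun N hN => ?_⟩
  have hN0 : (0 : ℝ) < N := by exact_mod_cast hN
  have h := abs_sum_div_sub_log_sq_le hC hN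
  have hdiv : ∀ n : ℕ, 1 / ((n : ℝ) * distNearestInt ((n : ℝ) * α)) =
      1 / distNearestInt ((n : ℝ) * α) / n := fun n => by rw [div_div, mul_comm]
  simp only [hdiv]
  set S := ∑ n ∈ Icc 1 N, 1 / distNearestInt ((n : ℝ) * α)
  have hS : |S / N - 2 * Real.log N| ≤ C := by
    have e : S / N - 2 * Real.log N = (S - 2 * N * Real.log N) / N := by field_simp
    rw [e, abs_div, abs_of_pos hN0, div_le_iff₀ hN0]
    exact hC N
  have hlog : Real.log N ≤ Real.log (max (Real.exp 1) N) :=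
    Real.log_le_log hN0 (le_max_right _ _)
  have hone : 1 ≤ Real.log (max (Real.exp 1) N) := by
    rw [Real.le_log_iff_exp_le (by positivity)]
    exact le_max_left _ _
  have hlog0 : 0 ≤ Real.log N := Real.log_natCast_nonneg N
  have h1 : (C + 6) * Real.log N ≤ (C + 6) * Real.log (max (Real.exp 1) N) := by gcongr
  have h2 : C * 1 ≤ C * Real.log (max (Real.exp 1) N) := by gcongr
  rw [abs_le] at h hS ⊢
  constructor <;> linarith [h.1, h.2, hS.1, hS.2]
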